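/- **Setting.** A de Morgan algebra is a bounded distributive lattice with an involution $r\mapsto 1-r$ satisfying $1-0=1$, $1-1=0$, $1-(r\vee s)=(1-r)\wedge(1-s)$ and $1-(r\wedge s)=(1-r)\vee(1-s)$; let $\mathsf{dM}(S)$ be the free de Morgan algebra on a set $S$. Fix a countably infinite set of names. The category of cubes $\mathcal C$ has as objects the finite sets $I,J,K,\dots$ of names; a morphism $f\colon J\to I$ is a map $I\to\mathsf{dM}(J)$; identities and composition are those of the Kleisli category of $\mathsf{dM}$ (substitution), the composite of $g\colon K\to J$ and $f\colon J\to I$ being written $fg\colon K\to I$. A cubical set is a presheaf on $\mathcal C$; restriction along $f$ is written $\rho\mapsto\rho f$. For a finite set of names $I$ and a name $i\notin I$ write $I,i$ for $I\cup\{i\}$. For $b\in\{0,1\}$ let $(ib)\colon I\to I,i$ be the morphism sending $i$ to $b$ and fixing every name in $I$; let $\mathsf s_i\colon I,i\to I$ be the morphism given by the inclusion $I\subseteq I,i$; and for $f\colon J\to I$ and $j\notin J$ let $(f,i=j)\colon J,j\to I,i$ be the morphism sending $i$ to $j$ and $k\in I$ to $f(k)$. The face lattice $\mathbb F(I)$ is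 the bounded distributive lattice generated by symbols $(i=0)$, $(i=1)$ for $i\in I$, subject to $(i=0)\wedge(i=1)=0$. For $r\in\mathsf{dM}(I)$, let $(r=1)\in\mathbb F(I)$ be the image of $r$ under the lattice homomorphism $\mathsf{dM}(I)\to\mathbb F(I)$ with $i\mapsto(i=1)$ and $1-i\mapsto(i=0)$, and let $(r=0)$ be $(1-r=1)$. For $\varphi\in\mathbb F(I)$ and $f\colon J\to I$, the element $\varphi f\in\mathbb F(J)$ is obtained by the lattice homomorphism sending $(i=1)$ to $(f(i)=1)$ and $(i=0)$ to $(f(i)=0)$. Let $\Gamma$ be a cubical set. A type $A$ over $\Gamma$ is a presheaf on the category of elements of $\Gamma$: sets $A\rho$ for $\rho\in\Gamma(I)$ with functorial restriction maps $A\rho\to A(\rho f)$, $a\mapsto af$. For $\rho\in\Gamma(K)$ and $\varphi\in\mathbb F(K)$, a partial element of $A\rho$ of extent $\varphi$ is a family of elements $u_f\in A(\rho f)$, for all $f\colon J\to K$ with $\varphi f=1$, such that $(u_f)g=u_{fg}$ for all $g\colon L\to J$. A (uniform) composition structure on $A$ consists of an element $$\mathrm{comp}(I,i,\rho,\varphi,u,a_0)\in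 A\rho(i1)$$ for every finite set of names $I$, name $i\notin I$, $\rho\in\Gamma(I,i)$, $\varphi\in\mathbb F(I)$, partial element $u$ of $A\rho$ of extent $\varphi\,\mathsf s_i\in\mathbb F(I,i)$, and $a_0\in A\rho(i0)$ such that $a_0f=u_{(i0)f}$ for all $f\colon J\to I$ with $\varphi f=1$; it is required that for all $f\colon J\to I$ and $j\notin J$ $$\mathrm{comp}(I,i,\rho,\varphi,u,a_0)\,f=\mathrm{comp}\bigl(J,j,\rho(f,i=j),\varphi f,u(f,i=j),a_0f\bigr),$$ where $(u(f,i=j))_g=u_{(f,i=j)g}$, and that $\mathrm{comp}(I,i,\rho,1,u,a_0)=u_{(i1)}$. A composition structure on a cubical set $Y$ is one on $Y$ regarded as a type over the terminal cubical set (whose fibre at the unique element of level $I$ is $Y(I)$). Each $f\colon J\to I$ induces a continuous map $[0,1]^J\to[0,1]^I$ whose $i$-th coordinate at $x\in[0,1]^J$ is the value of $f(i)\in\mathsf{dM}(J)$ at $x$, computed in the de Morgan algebra $[0,1]$ (with $\min$, $\max$ and $t\mapsto 1-t$). For a topological space $X$, the singular cubical set $\mathrm{Sing}(X)$ has as $I$-cubes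 the continuous maps $[0,1]^I\to X$, with restriction along $f$ given by precomposition with this map. **Corollary.** For every topological space $X$, the singular cubical set $\mathrm{Sing}(X)$ has a (uniform) composition structure. -/

import Mathlib

open CategoryTheory Opposite

universe u v

namespace Cubical

/-! ### De Morgan algebras and the free de Morgan algebra on a set -/

/-- A de Morgan algebra: a bounded distributive lattice with an involution `neg`
(written `1 - r` in informal notation) satisfying the de Morgan laws. -/
class DeMorganAlgebra (α : Type u) extends DistribLattice α, BoundedOrder α where
  neg : α → α
  neg_neg : ∀ r : α, neg (neg r) = r
  neg_bot : neg ⊥ = ⊤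
  neg_top : neg ⊤ = ⊥
  neg_sup : ∀ r s : α, neg (r ⊔ s) = neg r ⊓ neg s
  neg_inf : ∀ r s : α, neg (r ⊓ s) = neg r ⊔ neg s

/-- Formal expressions in the language of de Morgan algebras, with variables in `α`. -/
inductive DMTerm (α : Type u) : Type u
  | zero : DMTerm α
  | one : DMTerm α
  | var : α → DMTerm α
  | neg : DMTerm α → DMTerm α
  | inf : DMTerm α → DMTerm α → DMTerm α
  | sup : DMTerm α → DMTerm α → DMTerm α

/-- Provable equality of de Morgan expressions: the congruence generated by the axioms of
de Morgan algebras. -/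
inductive DMTerm.Eqv {α : Type u} : DMTerm α → DMTerm α → Prop
  | refl (r) : Eqv r r
  | symm {r s} : Eqv r s → Eqv s r
  | trans {r s t} : Eqv r s → Eqv s t → Eqv r t
  | neg_congr {r s} : Eqv r s → Eqv (neg r) (neg s)
  | inf_congr {r r₁ s s₁} : Eqv r r₁ → Eqv s s₁ → Eqv (inf r s) (inf r₁ s₁)
  | sup_congr {r r₁ s s₁} : Eqv r r₁ → Eqv s s₁ → Eqv (sup r s) (sup r₁ s₁)
  | inf_comm (r s) : Eqv (inf r s) (inf s r)
  | sup_comm (r s) : Eqv (sup r s) (sup s r)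
  | inf_assoc (r s t) : Eqv (inf (inf r s) t) (inf r (inf s t))
  | sup_assoc (r s t) : Eqv (sup (sup r s) t) (sup r (sup s t))
  | sup_inf_self (r s) : Eqv (sup r (inf r s)) r
  | inf_sup_self (r s) : Eqv (inf r (sup r s)) r
  | inf_sup_left (r s t) : Eqv (inf r (sup s t)) (sup (inf r s) (inf r t))
  | zero_sup (r) : Eqv (sup zero r) r
  | sup_one (r) : Eqv (sup r one) one
  | neg_neg (r) : Eqv (neg (neg r)) r
  | neg_zero : Eqv (neg zero) one
  | neg_one : Eqv (neg one) zero
  | neg_sup (r s) : Eqv (neg (sup r s)) (inf (neg r) (neg s))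
  | neg_inf (r s) : Eqv (neg (inf r s)) (sup (neg r) (neg s))

/-- The setoid of provable equality on de Morgan expressions. -/
def DMTerm.setoid (α : Type u) : Setoid (DMTerm α) :=
  ⟨DMTerm.Eqv, DMTerm.Eqv.refl, DMTerm.Eqv.symm, DMTerm.Eqv.trans⟩

/-- The free de Morgan algebra `dM(α)` on a set `α`. -/
def FreeDM (α : Type u) : Type u := Quotient (DMTerm.setoid α)

namespace FreeDM

variable {α β : Type u}

/-- The class of an expression. -/
def mk (t : DMTerm α) : FreeDM α := Quotient.mk (DMTerm.setoid α) t

/-- The generators of the free de Morgan algebra. -/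
def var (i : α) : FreeDM α := mk (.var i)

theorem mk_eq {s t : DMTerm α} (h : DMTerm.Eqv s t) : mk s = mk t := Quotient.sound h

theorem ind {p : FreeDM α → Prop} (h : ∀ t, p (mk t)) (r : FreeDM α) : p r :=
  Quotient.ind h r

/-- Join, on classes of expressions. -/
def join : FreeDM α → FreeDM α → FreeDM α :=
  Quotient.map₂ DMTerm.sup fun _ _ h _ _ k => DMTerm.Eqv.sup_congr h k

/-- Meet, on classes of expressions. -/
def meet : FreeDM α → FreeDM α → FreeDM α :=
  Quotient.map₂ DMTerm.inf fun _ _ h _ _ k => DMTerm.Eqv.inf_congr h k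

instance : Lattice (FreeDM α) :=
  @Lattice.mk' _ ⟨join⟩ ⟨meet⟩
    (by rintro ⟨r⟩ ⟨s⟩; exact mk_eq (.sup_comm r s))
    (by rintro ⟨r⟩ ⟨s⟩ ⟨t⟩; exact mk_eq (.sup_assoc r s t))
    (by rintro ⟨r⟩ ⟨s⟩; exact mk_eq (.inf_comm r s))
    (by rintro ⟨r⟩ ⟨s⟩ ⟨t⟩; exact mk_eq (.inf_assoc r s t))
    (by rintro ⟨r⟩ ⟨s⟩; exact mk_eq (.sup_inf_self r s))
    (by rintro ⟨r⟩ ⟨s⟩; exact mk_eq (.inf_sup_self r s))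

theorem mk_sup (s t : DMTerm α) : mk (.sup s t) = mk s ⊔ mk t := rfl

theorem mk_inf (s t : DMTerm α) : mk (.inf s t) = mk s ⊓ mk t := rfl

instance : DistribLattice (FreeDM α) :=
  DistribLattice.ofInfSupLe (by
    rintro ⟨r⟩ ⟨s⟩ ⟨t⟩; exact le_of_eq (mk_eq (.inf_sup_left r s t)))

instance : BoundedOrder (FreeDM α) where
  bot := mk .zero
  top := mk .one
  bot_le := by rintro ⟨r⟩; exact sup_eq_right.mp (mk_eq (.zero_sup r))
  le_top := by rintro ⟨r⟩; exact sup_eq_right.mp (mk_eq (.sup_one r))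

instance : DeMorganAlgebra (FreeDM α) where
  neg := Quotient.map DMTerm.neg fun _ _ h => DMTerm.Eqv.neg_congr h
  neg_neg := by rintro ⟨r⟩; exact mk_eq (.neg_neg r)
  neg_bot := mk_eq .neg_zero
  neg_top := mk_eq .neg_one
  neg_sup := by rintro ⟨r⟩ ⟨s⟩; exact mk_eq (.neg_sup r s)
  neg_inf := by rintro ⟨r⟩ ⟨s⟩; exact mk_eq (.neg_inf r s)

end FreeDM

/-- The value of an expression in a de Morgan algebra. -/
def DMTerm.eval {α : Type u} {D : Type v} [DeMorganAlgebra D] (e : α → D) : DMTerm α → D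
  | .zero => ⊥
  | .one => ⊤
  | .var i => e i
  | .neg r => DeMorganAlgebra.neg (r.eval e)
  | .inf r s => r.eval e ⊓ s.eval e
  | .sup r s => r.eval e ⊔ s.eval e

theorem DMTerm.eval_eqv {α : Type u} {D : Type v} [DeMorganAlgebra D] (e : α → D)
    {r s : DMTerm α} (h : DMTerm.Eqv r s) : r.eval e = s.eval e := by
  induction h with
  | refl => rfl
  | symm _ h => exact h.symm
  | trans _ _ h k => exact h.trans k
  | neg_congr _ h => simp only [eval, h]
  | inf_congr _ _ h k => simp only [eval, h, k]
  | sup_congr _ _ h k => simp only [eval, h, k]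
  | inf_comm => exact _root_.inf_comm _ _
  | sup_comm => exact _root_.sup_comm _ _
  | inf_assoc => exact _root_.inf_assoc _ _ _
  | sup_assoc => exact _root_.sup_assoc _ _ _
  | sup_inf_self => exact _root_.sup_inf_self
  | inf_sup_self => exact _root_.inf_sup_self
  | inf_sup_left => exact _root_.inf_sup_left _ _ _
  | zero_sup => exact bot_sup_eq _
  | sup_one => exact sup_top_eq _
  | neg_neg => exact DeMorganAlgebra.neg_neg _
  | neg_zero => exact DeMorganAlgebra.neg_bot
  | neg_one => exact DeMorganAlgebra.neg_top
  | neg_sup => exact DeMorganAlgebra.neg_sup _ _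
  | neg_inf => exact DeMorganAlgebra.neg_inf _ _

namespace FreeDM

variable {α β : Type u} {D : Type v} [DeMorganAlgebra D]

/-- The unique extension of `e : α → D` to a homomorphism `dM(α) → D` of de Morgan algebras.
For `D = dM(β)` this is the Kleisli extension of the monad `dM`. -/
def lift (e : α → D) : FreeDM α → D :=
  Quotient.lift (DMTerm.eval e) fun _ _ h => DMTerm.eval_eqv e h

@[simp] theorem lift_var (e : α → D) (i : α) : lift e (var i) = e i := rfl
@[simp] theorem lift_bot (e : α → D) : lift e ⊥ = ⊥ := rfl
@[simp] theorem lift_top (e : α → D) : lift e ⊤ = ⊤ := rfl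

@[simp] theorem lift_neg (e : α → D) (r : FreeDM α) :
    lift e (DeMorganAlgebra.neg r) = DeMorganAlgebra.neg (lift e r) := by
  rcases r with ⟨r⟩; rfl

@[simp] theorem lift_inf (e : α → D) (r s : FreeDM α) :
    lift e (r ⊓ s) = lift e r ⊓ lift e s := by
  rcases r with ⟨r⟩; rcases s with ⟨s⟩; rfl

@[simp] theorem lift_sup (e : α → D) (r s : FreeDM α) :
    lift e (r ⊔ s) = lift e r ⊔ lift e s := by
  rcases r with ⟨r⟩; rcases s with ⟨s⟩; rfl

/-- Induction on the elements of the free de Morgan algebra. -/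
theorem induction {p : FreeDM α → Prop} (bot : p ⊥) (top : p ⊤) (var : ∀ i, p (var i))
    (neg : ∀ r, p r → p (DeMorganAlgebra.neg r))
    (inf : ∀ r s, p r → p s → p (r ⊓ s)) (sup : ∀ r s, p r → p s → p (r ⊔ s))
    (r : FreeDM α) : p r := by
  refine ind (fun t => ?_) r
  induction t with
  | zero => exact bot
  | one => exact top
  | var i => exact var i
  | neg r h => exact neg _ h
  | inf r s h k => exact inf _ _ h k
  | sup r s h k => exact sup _ _ h k

theorem lift_var_id (r : FreeDM α) : lift (var : α → FreeDM α) r = r := by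
  induction r using FreeDM.induction <;> simp_all

theorem lift_lift (e : β → D) (f : α → FreeDM β) (r : FreeDM α) :
    lift e (lift f r) = lift (fun i => lift e (f i)) r := by
  induction r using FreeDM.induction <;> simp_all

end FreeDM

/-! ### The category of cubes -/

/-- The objects of the category of cubes: finite sets of names, where the countably infinite
discrete set of names is `ℕ`. -/
structure Cube : Type where
  names : Finset ℕ

/-- The type of names in `I`. -/
abbrev Cube.Names (I : Cube) : Type := {k : ℕ // k ∈ I.names}

/-- The category of cubes. A morphism `J ⟶ I` is a map `I → dM(J)`, and composition is
Kleisli composition (substitution). -/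
instance : Category.{0} Cube where
  Hom J I := I.Names → FreeDM J.Names
  id _ := FreeDM.var
  comp g f := fun k => FreeDM.lift g (f k)
  id_comp _ := funext fun _ => FreeDM.lift_var_id _
  comp_id _ := rfl
  assoc _ _ _ := funext fun _ => (FreeDM.lift_lift _ _ _).symm

namespace Cube

/-- The substitution `J ⟶ I` given by a map `I → dM(J)`. -/
def homOf {J I : Cube} (f : I.Names → FreeDM J.Names) : J ⟶ I := f

/-- The value `f(k) ∈ dM(J)` of a morphism `f : J ⟶ I` at a name `k ∈ I`. -/
def value {J I : Cube} (f : J ⟶ I) (k : I.Names) : FreeDM J.Names := f k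

@[ext] theorem hom_ext {J I : Cube} {f g : J ⟶ I} (h : ∀ k, value f k = value g k) : f = g :=
  funext h

@[simp] theorem value_homOf {J I : Cube} (f : I.Names → FreeDM J.Names) (k : I.Names) :
    value (homOf f) k = f k := rfl

@[simp] theorem value_id {I : Cube} (k : I.Names) : value (𝟙 I) k = FreeDM.var k := rfl

@[simp] theorem value_comp {K J I : Cube} (g : K ⟶ J) (f : J ⟶ I) (k : I.Names) :
    value (g ≫ f) k = FreeDM.lift (value g) (value f k) := rfl

/-- The cube `I, i`, i.e. `I ∪ {i}` (used only for names `i ∉ I`). -/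
def extend (I : Cube) (i : ℕ) : Cube := ⟨insert i I.names⟩

/-- A name of `I` seen as a name of `I, i`. -/
def old {I : Cube} (i : ℕ) (k : I.Names) : (I.extend i).Names :=
  ⟨k.1, Finset.mem_insert_of_mem k.2⟩

/-- The name `i` of `I, i`. -/
def new (I : Cube) (i : ℕ) : (I.extend i).Names := ⟨i, Finset.mem_insert_self i I.names⟩

/-- The map `I, i ⟶ I` induced by the inclusion `I ⊆ I, i`. -/
def degen (I : Cube) (i : ℕ) : I.extend i ⟶ I := homOf fun k => FreeDM.var (old i k)

/-- The face map `(ir) : I ⟶ I, i`, sending `i` to `r` and every name in `I` to itself. It is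
used for `r` the constants `0 = ⊥` and `1 = ⊤`. -/
def face (I : Cube) (i : ℕ) (r : FreeDM I.Names) : I ⟶ I.extend i :=
  homOf fun k => if h : k.1 ∈ I.names then FreeDM.var ⟨k.1, h⟩ else r

/-- The face map `(i0)`. -/
def face0 (I : Cube) (i : ℕ) : I ⟶ I.extend i := face I i ⊥

/-- The face map `(i1)`. -/
def face1 (I : Cube) (i : ℕ) : I ⟶ I.extend i := face I i ⊤

/-- For `f : J ⟶ I`, the map `(f, i = j) : J, j ⟶ I, i` that sends `i` to `j` and `k ∈ I` to
`f(k)`. -/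
def extendHom {J I : Cube} (f : J ⟶ I) (i j : ℕ) : J.extend j ⟶ I.extend i :=
  homOf fun k =>
    if h : k.1 ∈ I.names then value (degen J j ≫ f) ⟨k.1, h⟩ else FreeDM.var (new J j)

theorem degen_face {I : Cube} (i : ℕ) (r : FreeDM I.Names) : face I i r ≫ degen I i = 𝟙 I := by
  ext k
  simp [degen, face, old]

theorem extendHom_degen {J I : Cube} (f : J ⟶ I) (i j : ℕ) :
    extendHom f i j ≫ degen I i = degen J j ≫ f := by
  ext k
  simp [degen, extendHom, old]

theorem value_face_old {I : Cube} (i : ℕ) (r : FreeDM I.Names) (k : I.Names) :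
    value (face I i r) (old i k) = FreeDM.var k := by
  simp [face, old]

theorem value_face_new {I : Cube} {i : ℕ} (hi : i ∉ I.names) (r : FreeDM I.Names) :
    value (face I i r) (new I i) = r := by
  simp [face, new, hi]

theorem face_extendHom {J I : Cube} (f : J ⟶ I) (i : ℕ) {j : ℕ} (hj : j ∉ J.names)
    (r : FreeDM I.Names) (s : FreeDM J.Names) (hrs : FreeDM.lift (value f) r = s) :
    face J j s ≫ extendHom f i j = f ≫ face I i r := by
  ext k
  by_cases h : k.1 ∈ I.names
  · have e : ∀ q : FreeDM J.Names, FreeDM.lift (value (face J j s)) (FreeDM.lift (value (degen J j)) q) = q := by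
      intro q
      rw [FreeDM.lift_lift]
      exact (congrArg (fun m => FreeDM.lift (value m) q) (degen_face j s)).trans
        (FreeDM.lift_var_id q)
    simp only [value_comp, extendHom, value_homOf, h, dite_true, e]
    simp [face, h]
  · simp only [value_comp, extendHom, value_homOf, h, dite_false, FreeDM.lift_var,
      value_face_new hj]
    simp [face, h, hrs]

theorem face0_extendHom {J I : Cube} (f : J ⟶ I) (i : ℕ) {j : ℕ} (hj : j ∉ J.names) :
    face0 J j ≫ extendHom f i j = f ≫ face0 I i :=
  face_extendHom f i hj _ _ rfl

theorem face1_extendHom {J I : Cube} (f : J ⟶ I) (i : ℕ) {j : ℕ} (hj : j ∉ J.names) :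
    face1 J j ≫ extendHom f i j = f ≫ face1 I i :=
  face_extendHom f i hj _ _ rfl

end Cube

/-! ### The face lattice -/

/-- Formal expressions for face formulas with names in `α`; `eq0 i` and `eq1 i` stand for the
symbols `(i = 0)` and `(i = 1)`. -/
inductive FaceTerm (α : Type u) : Type u
  | zero : FaceTerm α
  | one : FaceTerm α
  | eq0 : α → FaceTerm α
  | eq1 : α → FaceTerm α
  | inf : FaceTerm α → FaceTerm α → FaceTerm α
  | sup : FaceTerm α → FaceTerm α → FaceTerm α

/-- Provable equality of face formulas: the congruence generated by the axioms of bounded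
distributive lattices and by the relations `(i = 0) ∧ (i = 1) = 0`. -/
inductive FaceTerm.Eqv {α : Type u} : FaceTerm α → FaceTerm α → Prop
  | refl (r) : Eqv r r
  | symm {r s} : Eqv r s → Eqv s r
  | trans {r s t} : Eqv r s → Eqv s t → Eqv r t
  | inf_congr {r r₁ s s₁} : Eqv r r₁ → Eqv s s₁ → Eqv (inf r s) (inf r₁ s₁)
  | sup_congr {r r₁ s s₁} : Eqv r r₁ → Eqv s s₁ → Eqv (sup r s) (sup r₁ s₁)
  | inf_comm (r s) : Eqv (inf r s) (inf s r)
  | sup_comm (r s) : Eqv (sup r s) (sup s r)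
  | inf_assoc (r s t) : Eqv (inf (inf r s) t) (inf r (inf s t))
  | sup_assoc (r s t) : Eqv (sup (sup r s) t) (sup r (sup s t))
  | sup_inf_self (r s) : Eqv (sup r (inf r s)) r
  | inf_sup_self (r s) : Eqv (inf r (sup r s)) r
  | inf_sup_left (r s t) : Eqv (inf r (sup s t)) (sup (inf r s) (inf r t))
  | zero_sup (r) : Eqv (sup zero r) r
  | sup_one (r) : Eqv (sup r one) one
  | eq0_inf_eq1 (i) : Eqv (inf (eq0 i) (eq1 i)) zero

/-- The setoid of provable equality on face formulas. -/
def FaceTerm.setoid (α : Type u) : Setoid (FaceTerm α) :=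
  ⟨FaceTerm.Eqv, FaceTerm.Eqv.refl, FaceTerm.Eqv.symm, FaceTerm.Eqv.trans⟩

/-- The face lattice on names in `α`: the bounded distributive lattice generated by the symbols
`(i = 0)` and `(i = 1)` subject to `(i = 0) ∧ (i = 1) = 0`. -/
def FaceLattice (α : Type u) : Type u := Quotient (FaceTerm.setoid α)

namespace FaceLattice

variable {α β : Type u}

/-- The class of a face formula. -/
def mk (t : FaceTerm α) : FaceLattice α := Quotient.mk (FaceTerm.setoid α) t

/-- The generator `(i = 0)`. -/
def eq0 (i : α) : FaceLattice α := mk (.eq0 i)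

/-- The generator `(i = 1)`. -/
def eq1 (i : α) : FaceLattice α := mk (.eq1 i)

theorem mk_eq {s t : FaceTerm α} (h : FaceTerm.Eqv s t) : mk s = mk t := Quotient.sound h

theorem ind {p : FaceLattice α → Prop} (h : ∀ t, p (mk t)) (r : FaceLattice α) : p r :=
  Quotient.ind h r

/-- Join, on classes of expressions. -/
def join : FaceLattice α → FaceLattice α → FaceLattice α :=
  Quotient.map₂ FaceTerm.sup fun _ _ h _ _ k => FaceTerm.Eqv.sup_congr h k

/-- Meet, on classes of expressions. -/
def meet : FaceLattice α → FaceLattice α → FaceLattice α :=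
  Quotient.map₂ FaceTerm.inf fun _ _ h _ _ k => FaceTerm.Eqv.inf_congr h k

instance : Lattice (FaceLattice α) :=
  @Lattice.mk' _ ⟨join⟩ ⟨meet⟩
    (by rintro ⟨r⟩ ⟨s⟩; exact mk_eq (.sup_comm r s))
    (by rintro ⟨r⟩ ⟨s⟩ ⟨t⟩; exact mk_eq (.sup_assoc r s t))
    (by rintro ⟨r⟩ ⟨s⟩; exact mk_eq (.inf_comm r s))
    (by rintro ⟨r⟩ ⟨s⟩ ⟨t⟩; exact mk_eq (.inf_assoc r s t))
    (by rintro ⟨r⟩ ⟨s⟩; exact mk_eq (.sup_inf_self r s))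
    (by rintro ⟨r⟩ ⟨s⟩; exact mk_eq (.inf_sup_self r s))

instance : DistribLattice (FaceLattice α) :=
  DistribLattice.ofInfSupLe (by
    rintro ⟨r⟩ ⟨s⟩ ⟨t⟩; exact le_of_eq (mk_eq (.inf_sup_left r s t)))

instance : BoundedOrder (FaceLattice α) where
  bot := mk .zero
  top := mk .one
  bot_le := by rintro ⟨r⟩; exact sup_eq_right.mp (mk_eq (.zero_sup r))
  le_top := by rintro ⟨r⟩; exact sup_eq_right.mp (mk_eq (.sup_one r))

theorem eq0_inf_eq1 (i : α) : eq0 i ⊓ eq1 i = ⊥ := mk_eq (.eq0_inf_eq1 i)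

/-- Induction on face formulas. -/
theorem induction {p : FaceLattice α → Prop} (bot : p ⊥) (top : p ⊤) (eq0 : ∀ i, p (eq0 i))
    (eq1 : ∀ i, p (eq1 i)) (inf : ∀ r s, p r → p s → p (r ⊓ s))
    (sup : ∀ r s, p r → p s → p (r ⊔ s)) (r : FaceLattice α) : p r := by
  refine ind (fun t => ?_) r
  induction t with
  | zero => exact bot
  | one => exact top
  | eq0 i => exact eq0 i
  | eq1 i => exact eq1 i
  | inf r s h k => exact inf _ _ h k
  | sup r s h k => exact sup _ _ h k

end FaceLattice

/-- The value of a face formula in a bounded distributive lattice, given values `e₀ i` and `e₁ i`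
for the symbols `(i = 0)` and `(i = 1)`. -/
def FaceTerm.eval {α : Type u} {D : Type v} [DistribLattice D] [BoundedOrder D]
    (e₀ e₁ : α → D) : FaceTerm α → D
  | .zero => ⊥
  | .one => ⊤
  | .eq0 i => e₀ i
  | .eq1 i => e₁ i
  | .inf r s => r.eval e₀ e₁ ⊓ s.eval e₀ e₁
  | .sup r s => r.eval e₀ e₁ ⊔ s.eval e₀ e₁

theorem FaceTerm.eval_eqv {α : Type u} {D : Type v} [DistribLattice D] [BoundedOrder D]
    (e₀ e₁ : α → D) (he : ∀ i, e₀ i ⊓ e₁ i = ⊥) {r s : FaceTerm α} (h : FaceTerm.Eqv r s) :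
    r.eval e₀ e₁ = s.eval e₀ e₁ := by
  induction h with
  | refl => rfl
  | symm _ h => exact h.symm
  | trans _ _ h k => exact h.trans k
  | inf_congr _ _ h k => simp only [eval, h, k]
  | sup_congr _ _ h k => simp only [eval, h, k]
  | inf_comm => exact _root_.inf_comm _ _
  | sup_comm => exact _root_.sup_comm _ _
  | inf_assoc => exact _root_.inf_assoc _ _ _
  | sup_assoc => exact _root_.sup_assoc _ _ _
  | sup_inf_self => exact _root_.sup_inf_self
  | inf_sup_self => exact _root_.inf_sup_self
  | inf_sup_left => exact _root_.inf_sup_left _ _ _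
  | zero_sup => exact bot_sup_eq _
  | sup_one => exact sup_top_eq _
  | eq0_inf_eq1 i => exact he i

namespace FaceLattice

variable {α β γ : Type u} {D : Type v} [DistribLattice D] [BoundedOrder D]

/-- The homomorphism of bounded lattices out of the face lattice with prescribed values `e₀ i`,
`e₁ i` at `(i = 0)`, `(i = 1)`, where `e₀ i ⊓ e₁ i = ⊥`. -/
def lift (e₀ e₁ : α → D) (he : ∀ i, e₀ i ⊓ e₁ i = ⊥) : FaceLattice α → D :=
  Quotient.lift (FaceTerm.eval e₀ e₁) fun _ _ h => FaceTerm.eval_eqv e₀ e₁ he h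

section

variable (e₀ e₁ : α → D) (he : ∀ i, e₀ i ⊓ e₁ i = ⊥)

@[simp] theorem lift_eq0 (i : α) : lift e₀ e₁ he (eq0 i) = e₀ i := rfl
@[simp] theorem lift_eq1 (i : α) : lift e₀ e₁ he (eq1 i) = e₁ i := rfl
@[simp] theorem lift_bot : lift e₀ e₁ he ⊥ = ⊥ := rfl
@[simp] theorem lift_top : lift e₀ e₁ he ⊤ = ⊤ := rfl

@[simp] theorem lift_inf (r s : FaceLattice α) :
    lift e₀ e₁ he (r ⊓ s) = lift e₀ e₁ he r ⊓ lift e₀ e₁ he s := by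
  rcases r with ⟨r⟩; rcases s with ⟨s⟩; rfl

@[simp] theorem lift_sup (r s : FaceLattice α) :
    lift e₀ e₁ he (r ⊔ s) = lift e₀ e₁ he r ⊔ lift e₀ e₁ he s := by
  rcases r with ⟨r⟩; rcases s with ⟨s⟩; rfl

end

/-- For a bounded distributive lattice `L`, the product of `L` with its order dual is a
de Morgan algebra with `neg (a, b) = (b, a)`. -/
instance dualPair {L : Type v} [DistribLattice L] [BoundedOrder L] :
    DeMorganAlgebra (L × Lᵒᵈ) where
  neg p := (OrderDual.ofDual p.2, OrderDual.toDual p.1)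
  neg_neg _ := rfl
  neg_bot := rfl
  neg_top := rfl
  neg_sup _ _ := rfl
  neg_inf _ _ := rfl

/-- The pair `((r = 1), (r = 0))` attached to `r` in the free de Morgan algebra. -/
def eqPair (r : FreeDM α) : FaceLattice α × (FaceLattice α)ᵒᵈ :=
  FreeDM.lift (fun i => (eq1 i, OrderDual.toDual (eq0 i))) r

/-- The face formula `(r = 1)`. As a function of `r` this is the lattice homomorphism from the
free de Morgan algebra to the face lattice with `i ↦ (i = 1)` and `1 - i ↦ (i = 0)`. -/
def isOne (r : FreeDM α) : FaceLattice α := (eqPair r).1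

/-- The face formula `(r = 0)`, which is `(1 - r = 1)`. -/
def isZero (r : FreeDM α) : FaceLattice α := isOne (DeMorganAlgebra.neg r)

@[simp] theorem isOne_var (i : α) : isOne (FreeDM.var i) = eq1 i := rfl
@[simp] theorem isOne_bot : isOne (⊥ : FreeDM α) = ⊥ := rfl
@[simp] theorem isOne_top : isOne (⊤ : FreeDM α) = ⊤ := rfl
@[simp] theorem isOne_neg (r : FreeDM α) : isOne (DeMorganAlgebra.neg r) = isZero r := rfl
@[simp] theorem isOne_inf (r s : FreeDM α) : isOne (r ⊓ s) = isOne r ⊓ isOne s := by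
  simp only [isOne, eqPair, FreeDM.lift_inf]; rfl
@[simp] theorem isOne_sup (r s : FreeDM α) : isOne (r ⊔ s) = isOne r ⊔ isOne s := by
  simp only [isOne, eqPair, FreeDM.lift_sup]; rfl

@[simp] theorem isZero_var (i : α) : isZero (FreeDM.var i) = eq0 i := rfl
@[simp] theorem isZero_bot : isZero (⊥ : FreeDM α) = ⊤ := rfl
@[simp] theorem isZero_top : isZero (⊤ : FreeDM α) = ⊥ := rfl
@[simp] theorem isZero_neg (r : FreeDM α) : isZero (DeMorganAlgebra.neg r) = isOne r := by
  rw [isZero, DeMorganAlgebra.neg_neg]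
@[simp] theorem isZero_inf (r s : FreeDM α) : isZero (r ⊓ s) = isZero r ⊔ isZero s := by
  rw [isZero, DeMorganAlgebra.neg_inf, isOne_sup]; rfl
@[simp] theorem isZero_sup (r s : FreeDM α) : isZero (r ⊔ s) = isZero r ⊓ isZero s := by
  rw [isZero, DeMorganAlgebra.neg_sup, isOne_inf]; rfl

theorem isZero_inf_isOne (r : FreeDM α) : isZero r ⊓ isOne r = ⊥ := by
  induction r using FreeDM.induction with
  | bot => simp
  | top => simp
  | var i => exact eq0_inf_eq1 i
  | neg r h => rw [isZero_neg, isOne_neg, inf_comm, h]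
  | inf r s h k =>
    rw [isZero_inf, isOne_inf, inf_sup_right, ← inf_assoc, h, bot_inf_eq, inf_left_comm, k,
      inf_bot_eq, sup_bot_eq]
  | sup r s h k =>
    rw [isZero_sup, isOne_sup, inf_sup_left, inf_right_comm, h, bot_inf_eq, inf_assoc, k,
      inf_bot_eq, sup_bot_eq]

/-- Substitution `φ ↦ φ f` in face formulas along `f : α → dM(β)`: the lattice homomorphism
sending `(i = 1)` to `(f(i) = 1)` and `(i = 0)` to `(f(i) = 0)`. -/
def subst (f : α → FreeDM β) : FaceLattice α → FaceLattice β :=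
  lift (fun i => isZero (f i)) (fun i => isOne (f i)) fun i => isZero_inf_isOne (f i)

section

variable (f : α → FreeDM β)

@[simp] theorem subst_eq0 (i : α) : subst f (eq0 i) = isZero (f i) := rfl
@[simp] theorem subst_eq1 (i : α) : subst f (eq1 i) = isOne (f i) := rfl
@[simp] theorem subst_bot : subst f ⊥ = ⊥ := rfl
@[simp] theorem subst_top : subst f ⊤ = ⊤ := rfl
@[simp] theorem subst_inf (r s : FaceLattice α) :
    subst f (r ⊓ s) = subst f r ⊓ subst f s := lift_inf _ _ _ _ _
@[simp] theorem subst_sup (r s : FaceLattice α) :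
    subst f (r ⊔ s) = subst f r ⊔ subst f s := lift_sup _ _ _ _ _

theorem subst_isOne_isZero (r : FreeDM α) :
    subst f (isOne r) = isOne (FreeDM.lift f r) ∧
      subst f (isZero r) = isZero (FreeDM.lift f r) := by
  induction r using FreeDM.induction <;> simp_all

theorem subst_var (φ : FaceLattice α) : subst FreeDM.var φ = φ := by
  induction φ using FaceLattice.induction <;> simp_all

theorem subst_subst (g : β → FreeDM γ) (φ : FaceLattice α) :
    subst g (subst f φ) = subst (fun i => FreeDM.lift g (f i)) φ := by
  induction φ using FaceLattice.induction <;> simp_all [subst_isOne_isZero]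

end

end FaceLattice

/-- `𝔽(I)`: the face formulas that only use names in `I`. -/
abbrev Cube.Face (I : Cube) : Type := FaceLattice I.Names

/-- The restriction `φ f ∈ 𝔽(J)` of `φ ∈ 𝔽(I)` along `f : J ⟶ I`. -/
def Cube.Face.restrict {I J : Cube} (φ : I.Face) (f : J ⟶ I) : J.Face :=
  FaceLattice.subst (Cube.value f) φ

theorem Cube.Face.restrict_id {I : Cube} (φ : I.Face) : φ.restrict (𝟙 I) = φ :=
  FaceLattice.subst_var φ

theorem Cube.Face.restrict_comp {I J K : Cube} (φ : I.Face) (f : J ⟶ I) (g : K ⟶ J) :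
    φ.restrict (g ≫ f) = (φ.restrict f).restrict g :=
  (FaceLattice.subst_subst _ _ _).symm

@[simp] theorem Cube.Face.restrict_top {I J : Cube} (f : J ⟶ I) :
    Cube.Face.restrict (⊤ : I.Face) f = ⊤ := rfl

theorem Cube.Face.restrict_comp_eq_top {I J K : Cube} {φ : I.Face} {f : J ⟶ I}
    (h : φ.restrict f = ⊤) (g : K ⟶ J) : φ.restrict (g ≫ f) = ⊤ := by
  rw [Cube.Face.restrict_comp, h, Cube.Face.restrict_top]

theorem Cube.Face.restrict_degen_extendHom {I J K : Cube} {φ : I.Face} {f : J ⟶ I} {i j : ℕ}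
    {g : K ⟶ J.extend j}
    (h : ((φ.restrict f).restrict (Cube.degen J j)).restrict g = ⊤) :
    (φ.restrict (Cube.degen I i)).restrict (g ≫ Cube.extendHom f i j) = ⊤ := by
  rwa [← Cube.Face.restrict_comp, Category.assoc, Cube.extendHom_degen,
    Cube.Face.restrict_comp, Cube.Face.restrict_comp]

theorem Cube.Face.restrict_degen_face0 {I J : Cube} {φ : I.Face} {i : ℕ} {f : J ⟶ I}
    (h : φ.restrict f = ⊤) :
    (φ.restrict (Cube.degen I i)).restrict (f ≫ Cube.face0 I i) = ⊤ := by
  rwa [← Cube.Face.restrict_comp, Category.assoc, Cube.face0, Cube.degen_face, Category.comp_id]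

/-! ### Cubical sets and types over them -/

/-- A cubical set: a presheaf on the category of cubes. -/
abbrev CubicalSet : Type (u + 1) := Cubeᵒᵖ ⥤ Type u

/-- The restriction `ρ f ∈ Γ(J)` of `ρ ∈ Γ(I)` along `f : J ⟶ I`. -/
def CubicalSet.res {Γ : CubicalSet.{u}} {I J : Cube} (ρ : Γ.obj (op I)) (f : J ⟶ I) :
    Γ.obj (op J) :=
  Γ.map f.op ρ

theorem CubicalSet.res_id {Γ : CubicalSet.{u}} {I : Cube} (ρ : Γ.obj (op I)) :
    CubicalSet.res ρ (𝟙 I) = ρ := by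
  simp [CubicalSet.res]

theorem CubicalSet.res_res {Γ : CubicalSet.{u}} {I J K : Cube} (ρ : Γ.obj (op I)) (f : J ⟶ I)
    (g : K ⟶ J) :
    CubicalSet.res (CubicalSet.res ρ f) g = CubicalSet.res ρ (g ≫ f) := by
  simp [CubicalSet.res]

/-- A type `A ∈ Ty(Γ)` over a cubical set `Γ`: a presheaf on the category of elements of `Γ`.
(Mathlib's category of elements of the functor `Γ` on `Cubeᵒᵖ` is the opposite of the category
of elements of the presheaf `Γ`.) -/
abbrev Ty (Γ : CubicalSet.{u}) : Type (max u (v + 1)) := Γ.Elements ⥤ Type v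

namespace Ty

variable {Γ : CubicalSet.{u}} (A : Ty.{u, v} Γ)

/-- The set `A ρ` for `ρ ∈ Γ(I)`. -/
def fib {I : Cube} (ρ : Γ.obj (op I)) : Type v := A.obj (Γ.elementsMk (op I) ρ)

/-- The restriction map `A ρ → A (ρ f)`, `a ↦ a f`. The target is given as `A σ` together with a
proof of `ρ f = σ`. -/
def res {A : Ty.{u, v} Γ} {I J : Cube} {ρ : Γ.obj (op I)} (a : A.fib ρ) (f : J ⟶ I)
    {σ : Γ.obj (op J)} (h : CubicalSet.res ρ f = σ) : A.fib σ :=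
  A.map (CategoryOfElements.homMk (Γ.elementsMk (op I) ρ) (Γ.elementsMk (op J) σ) f.op h) a

theorem res_id {A : Ty.{u, v} Γ} {I : Cube} {ρ : Γ.obj (op I)} (a : A.fib ρ) :
    res a (𝟙 I) (CubicalSet.res_id ρ) = a := by
  have h : CategoryOfElements.homMk (Γ.elementsMk (op I) ρ) (Γ.elementsMk (op I) ρ) (𝟙 I).op
      (CubicalSet.res_id ρ) = 𝟙 _ := by ext; rfl
  unfold res
  rw [h]
  exact A.map_id_apply _ a

theorem res_res {A : Ty.{u, v} Γ} {I J K : Cube} {ρ : Γ.obj (op I)} (a : A.fib ρ) (f : J ⟶ I)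
    {σ : Γ.obj (op J)} (h : CubicalSet.res ρ f = σ) (g : K ⟶ J) {τ : Γ.obj (op K)}
    (k : CubicalSet.res σ g = τ) :
    res (res a f h) g k
      = res a (g ≫ f) (by rw [← CubicalSet.res_res, h, k]) := by
  exact (A.map_comp_apply _ _ a).symm

/-- The equality `A σ = A τ` for `σ = τ`, as a map. -/
def transport {A : Ty.{u, v} Γ} {J : Cube} {σ τ : Γ.obj (op J)} (h : σ = τ) (a : A.fib σ) :
    A.fib τ :=
  res a (𝟙 J) ((CubicalSet.res_id σ).trans h)

theorem transport_rfl {A : Ty.{u, v} Γ} {J : Cube} {σ : Γ.obj (op J)} (a : A.fib σ) :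
    transport rfl a = a := res_id a

end Ty

/-! ### Partial elements, composition structures, fibrant cubical sets -/

/-- For `ρ ∈ Γ(K)` and `φ ∈ 𝔽(K)`, a partial element of `A ρ` of extent `φ`: elements
`u_f ∈ A (ρ f)` for all `f : J ⟶ K` with `φ f = 1`, such that `(u_f) g = u_{f g}`. -/
structure PartialElement {Γ : CubicalSet.{u}} (A : Ty.{u, v} Γ) {K : Cube} (ρ : Γ.obj (op K))
    (φ : K.Face) where
  val : ∀ {J : Cube} (f : J ⟶ K), φ.restrict f = ⊤ → A.fib (CubicalSet.res ρ f)
  res_val : ∀ {J L : Cube} (f : J ⟶ K) (h : φ.restrict f = ⊤) (g : L ⟶ J),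
    Ty.res (val f h) g (CubicalSet.res_res ρ f g)
      = val (g ≫ f) (Cube.Face.restrict_comp_eq_top h g)

theorem PartialElement.transport_val {Γ : CubicalSet.{u}} {A : Ty.{u, v} Γ} {K J : Cube}
    {ρ : Γ.obj (op K)} {φ : K.Face} (u : PartialElement A ρ φ) {f g : J ⟶ K} (e : f = g)
    (h : φ.restrict f = ⊤) (k : φ.restrict g = ⊤) {σ : Γ.obj (op J)}
    (p : CubicalSet.res ρ f = σ) (q : CubicalSet.res ρ g = σ) :
    Ty.transport p (u.val f h) = Ty.transport q (u.val g k) := by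
  subst e
  rfl

/-- For `u` a partial element of `A ρ`, with `ρ ∈ Γ(I, i)`, of extent `φ ∈ 𝔽(I)`, and
`f : J ⟶ I`, the partial element `u (f, i = j)` of `A (ρ (f, i = j))` of extent `φ f`; its value
at `g` is `u_{(f, i = j) g}`. -/
def PartialElement.pullback {Γ : CubicalSet.{u}} {A : Ty.{u, v} Γ} {I J : Cube} {i : ℕ}
    {ρ : Γ.obj (op (I.extend i))} {φ : I.Face}
    (u : PartialElement A ρ (φ.restrict (Cube.degen I i))) (f : J ⟶ I) (j : ℕ) :
    PartialElement A (CubicalSet.res ρ (Cube.extendHom f i j))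
      ((φ.restrict f).restrict (Cube.degen J j)) where
  val g h := Ty.transport (CubicalSet.res_res ρ (Cube.extendHom f i j) g).symm
    (u.val (g ≫ Cube.extendHom f i j) (Cube.Face.restrict_degen_extendHom h))
  res_val g h k := by
    have e := u.res_val (g ≫ Cube.extendHom f i j) (Cube.Face.restrict_degen_extendHom h) k
    have q : CubicalSet.res ρ (k ≫ g ≫ Cube.extendHom f i j)
        = CubicalSet.res (CubicalSet.res ρ (Cube.extendHom f i j)) (k ≫ g) := by
      rw [CubicalSet.res_res, Category.assoc]
    refine Eq.trans ?_ (u.transport_val (Category.assoc _ _ _).symm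
      (Cube.Face.restrict_comp_eq_top (Cube.Face.restrict_degen_extendHom h) k) _ q
      (CubicalSet.res_res _ _ _).symm)
    rw [← e]
    unfold Ty.transport
    rw [Ty.res_res, Ty.res_res]
    congr 1
    rw [Category.comp_id, Category.id_comp]

/-- The input `(I, i, ρ, φ, u, a₀)` of a composition operation for `A ∈ Ty(Γ)`: a finite set of
names `I`, a name `i ∉ I`, `ρ ∈ Γ(I, i)`, `φ ∈ 𝔽(I)`, a partial element `u` of `A ρ` of extent
`φ`, and `a₀ ∈ A ρ(i0)` such that `a₀ f = u_{(i0) f}` for all `f : J ⟶ I` with `φ f = 1`. -/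
structure CompInput {Γ : CubicalSet.{u}} (A : Ty.{u, v} Γ) (I : Cube) (i : ℕ) where
  fresh : i ∉ I.names
  base : Γ.obj (op (I.extend i))
  extent : I.Face
  side : PartialElement A base (extent.restrict (Cube.degen I i))
  cap : A.fib (CubicalSet.res base (Cube.face0 I i))
  cap_res : ∀ {J : Cube} (f : J ⟶ I) (h : extent.restrict f = ⊤),
    Ty.res cap f (CubicalSet.res_res base (Cube.face0 I i) f)
      = side.val (f ≫ Cube.face0 I i) (Cube.Face.restrict_degen_face0 h)

theorem res_face0_extendHom {Γ : CubicalSet.{u}} {I J : Cube} {i j : ℕ}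
    (ρ : Γ.obj (op (I.extend i))) (f : J ⟶ I) (hj : j ∉ J.names) :
    CubicalSet.res (CubicalSet.res ρ (Cube.face0 I i)) f
      = CubicalSet.res (CubicalSet.res ρ (Cube.extendHom f i j)) (Cube.face0 J j) := by
  rw [CubicalSet.res_res, CubicalSet.res_res, Cube.face0_extendHom f i hj]

theorem res_face1_extendHom {Γ : CubicalSet.{u}} {I J : Cube} {i j : ℕ}
    (ρ : Γ.obj (op (I.extend i))) (f : J ⟶ I) (hj : j ∉ J.names) :
    CubicalSet.res (CubicalSet.res ρ (Cube.face1 I i)) f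
      = CubicalSet.res (CubicalSet.res ρ (Cube.extendHom f i j)) (Cube.face1 J j) := by
  rw [CubicalSet.res_res, CubicalSet.res_res, Cube.face1_extendHom f i hj]

/-- The input `(J, j, ρ (f, i = j), φ f, u (f, i = j), a₀ f)`, for `f : J ⟶ I` and `j ∉ J`. -/
def CompInput.pullback {Γ : CubicalSet.{u}} {A : Ty.{u, v} Γ} {I J : Cube} {i : ℕ}
    (x : CompInput A I i) (f : J ⟶ I) (j : ℕ) (hj : j ∉ J.names) : CompInput A J j where
  fresh := hj
  base := CubicalSet.res x.base (Cube.extendHom f i j)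
  extent := x.extent.restrict f
  side := x.side.pullback f j
  cap := Ty.res x.cap f (res_face0_extendHom x.base f hj)
  cap_res g h := by
    have hp : x.extent.restrict (g ≫ f) = ⊤ := by rwa [Cube.Face.restrict_comp]
    have q : CubicalSet.res x.base ((g ≫ f) ≫ Cube.face0 I i)
        = CubicalSet.res (CubicalSet.res x.base (Cube.extendHom f i j)) (g ≫ Cube.face0 J j) := by
      rw [CubicalSet.res_res, Category.assoc, Category.assoc, Cube.face0_extendHom f i hj]
    refine Eq.trans ?_ (x.side.transport_val
      (by rw [Category.assoc, Category.assoc, Cube.face0_extendHom f i hj])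
      (Cube.Face.restrict_degen_face0 hp) _ q (CubicalSet.res_res _ _ _).symm)
    rw [← x.cap_res (g ≫ f) hp]
    unfold Ty.transport
    rw [Ty.res_res, Ty.res_res]
    congr 1
    rw [Category.id_comp]

/-- A composition structure for `A ∈ Ty(Γ)`: operations
`comp (I, i, ρ, φ, u, a₀) ∈ A ρ(i1)` that are uniform, i.e.
`(comp (I, i, ρ, φ, u, a₀)) f = comp (J, j, ρ (f, i = j), φ f, u (f, i = j), a₀ f)` for all
`f : J ⟶ I` and `j ∉ J`, and satisfy `comp (I, i, ρ, 1, u, a₀) = u_{(i1)}`. -/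
structure CompositionStructure {Γ : CubicalSet.{u}} (A : Ty.{u, v} Γ) where
  comp : ∀ {I : Cube} {i : ℕ} (x : CompInput A I i),
    A.fib (CubicalSet.res x.base (Cube.face1 I i))
  uniform : ∀ {I J : Cube} {i : ℕ} (x : CompInput A I i) (f : J ⟶ I) (j : ℕ) (hj : j ∉ J.names),
    Ty.res (comp x) f (res_face1_extendHom x.base f hj) = comp (x.pullback f j hj)
  comp_top : ∀ {I : Cube} {i : ℕ} (x : CompInput A I i) (h : x.extent = ⊤),
    comp x = x.side.val (Cube.face1 I i)
      (by rw [h, Cube.Face.restrict_top, Cube.Face.restrict_top])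

/-- The terminal cubical set. -/
def terminalCubicalSet : CubicalSet.{0} := (Functor.const _).obj PUnit

/-- A cubical set `X` considered as a type over the terminal cubical set:
`X' ρ = X(I)` for `ρ ∈ ⊤(I)`. -/
def CubicalSet.asTy (X : CubicalSet.{u}) : Ty.{0, u} terminalCubicalSet :=
  CategoryOfElements.π terminalCubicalSet ⋙ X

/-- A composition structure on a cubical set, i.e. one on it as a type over the terminal cubical
set. A cubical set is fibrant if it has one. -/
abbrev CubicalSet.CompStructure (X : CubicalSet.{u}) : Type u :=
  CompositionStructure X.asTy

/-! ### Singular cubical sets -/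

/-- The canonical de Morgan algebra structure of the unit interval: minimum, maximum and
`1 - r`. -/
noncomputable instance : DeMorganAlgebra unitInterval where
  neg := unitInterval.symm
  neg_neg := unitInterval.symm_symm
  neg_bot := unitInterval.symm_zero
  neg_top := unitInterval.symm_one
  neg_sup r s := by
    rcases le_total r s with h | h
    · rw [sup_eq_right.mpr h, inf_eq_right.mpr (unitInterval.symm_le_symm.mpr h)]
    · rw [sup_eq_left.mpr h, inf_eq_left.mpr (unitInterval.symm_le_symm.mpr h)]
  neg_inf r s := by
    rcases le_total r s with h | h
    · rw [inf_eq_left.mpr h, sup_eq_left.mpr (unitInterval.symm_le_symm.mpr h)]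
    · rw [inf_eq_right.mpr h, sup_eq_right.mpr (unitInterval.symm_le_symm.mpr h)]

/-- The topological cube `[0,1]^I`. -/
abbrev Cube.Space (I : Cube) : Type := I.Names → unitInterval

theorem continuous_lift_unitInterval {α : Type u} (r : FreeDM α) :
    Continuous fun x : α → unitInterval => FreeDM.lift x r := by
  induction r using FreeDM.induction with
  | bot => exact continuous_const
  | top => exact continuous_const
  | var i => exact continuous_apply i
  | neg r h =>
    simp only [FreeDM.lift_neg]
    exact unitInterval.continuous_symm.comp h
  | inf r s h k => simpa using h.min k
  | sup r s h k => simpa using h.max k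

/-- The continuous map `[0,1]^J → [0,1]^I` induced by `f : J ⟶ I`, whose `i`-th coordinate at `x`
is the value of `f(i) ∈ dM(J)` at `x`. -/
noncomputable def Cube.realize {J I : Cube} (f : J ⟶ I) : C(J.Space, I.Space) where
  toFun x i := FreeDM.lift x (Cube.value f i)
  continuous_toFun := continuous_pi fun i => continuous_lift_unitInterval (Cube.value f i)

theorem Cube.realize_id (I : Cube) : Cube.realize (𝟙 I) = ContinuousMap.id I.Space := rfl

theorem Cube.realize_comp {K J I : Cube} (g : K ⟶ J) (f : J ⟶ I) :
    Cube.realize (g ≫ f) = (Cube.realize f).comp (Cube.realize g) := by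
  ext x i
  exact congrArg Subtype.val (FreeDM.lift_lift x (Cube.value g) (Cube.value f i))

/-- The singular cubical set of a topological space `X`: its `I`-cubes are the continuous maps
`[0,1]^I → X`, and restriction along `f : J ⟶ I` is composition with `[0,1]^J → [0,1]^I`. -/
noncomputable def Sing (X : Type u) [TopologicalSpace X] : CubicalSet.{u} where
  obj I := C(I.unop.Space, X)
  map f := TypeCat.ofHom fun s => s.comp (Cube.realize f.unop)
  map_id _ := rfl
  map_comp f g := by
    ext s
    simp [Cube.realize_comp, ContinuousMap.comp_assoc]

end Cubical

/-! A composition problem gives a map on an open box in [0,1]^(I,i): the cap on i = 0 and the sides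
over the points where φ holds. It suffices to send each x in [0,1]^I to a point of this box,
continuously in x, naturally in all morphisms of cubes (connections, reversals and diagonals
included), and with value (x, 1) when φ = 1. The composite is then the box map at that point.
Naturality comes from using only operations compatible with the de Morgan structure of [0,1]. The
formula φ gets a degree d(x) in [0,1] by interpreting (k = 1) as max(0, 2x_k - 1) and (k = 0) as the
same function of 1 - x_k. This respects (k = 0) ∧ (k = 1) = 0, and it is natural by
`FaceLattice.degree_subst`. The point x is then dilated about the centre of the cube by 1 / max(d,
1/2), with truncation. In each coordinate this is a de Morgan endomorphism of [0,1], so it commutes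
with every morphism. The new coordinate is max(0, 2d - 1). If d ≤ 1/2, it is 0 and the point lies on
the cap; if d ≥ 1/2, dilation multiplies the degree by 1/d up to truncation, so the degree becomes 1
and the point lies on the sides (`Cube.boxPoint_mem`). If d = 1, nothing moves and the height is 1.
It remains to see that a partial element of Sing(X) is a continuous map on the set of degree 1. The
value u_f(y) depends only on the image of y under f (`toMap_val_eq_faceHom`), because a de Morgan
polynomial taking the value 0 or 1 at an interior point is constant, so that morphisms factor
through faces. Continuity follows by pasting over finitely many closed faces (`continuousOn_glue`).
-/

namespace Cubical

/-! ### De Morgan endomorphisms of the unit interval -/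

/-- On a chain, monotone maps preserve min and max, and symmetry together with g 0 = 0 forces g 1 =
1. Hence g is a de Morgan endomorphism, and applying it to every coordinate commutes with the
realization of any morphism of cubes. -/
theorem FreeDM.map_lift_unitInterval {α : Type u} (g : unitInterval → unitInterval)
    (hg : Monotone g) (hg0 : g 0 = 0) (hgs : ∀ t, g (unitInterval.symm t) = unitInterval.symm (g t))
    (x : α → unitInterval) (r : FreeDM α) :
    FreeDM.lift (fun i => g (x i)) r = g (FreeDM.lift x r) := by
  induction r using FreeDM.induction with
  | bot => exact hg0.symm
  | top =>
    have h := hgs 0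
    rw [hg0, unitInterval.symm_zero] at h
    exact h.symm
  | var i => rfl
  | neg r h =>
    rw [FreeDM.lift_neg, FreeDM.lift_neg, h]
    exact (hgs _).symm
  | inf r s h k => rw [FreeDM.lift_inf, FreeDM.lift_inf, h, k, hg.map_inf]
  | sup r s h k => rw [FreeDM.lift_sup, FreeDM.lift_sup, h, k, hg.map_sup]

/-- A de Morgan polynomial taking an extreme value at a point of the open cube is constant. -/
theorem FreeDM.eq_bot_or_top_of_interior {α : Type u} {y : α → unitInterval}
    (hy : ∀ k, y k ≠ 0 ∧ y k ≠ 1) (r : FreeDM α) :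
    (FreeDM.lift y r = 0 → r = ⊥) ∧ (FreeDM.lift y r = 1 → r = ⊤) := by
  have e0 : (0 : unitInterval) = ⊥ := rfl
  have e1 : (1 : unitInterval) = ⊤ := rfl
  induction r using FreeDM.induction with
  | bot => simp [e0, e1]
  | top => simp [e0, e1]
  | var i => exact ⟨fun h => absurd h (hy i).1, fun h => absurd h (hy i).2⟩
  -- Negation exchanges the two implications, so they need a joint induction.
  | neg r h =>
    rw [FreeDM.lift_neg]
    refine ⟨fun k => ?_, fun k => ?_⟩
    · rw [h.2 (unitInterval.symm_eq_zero.mp k), DeMorganAlgebra.neg_top]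
    · rw [h.1 (unitInterval.symm_eq_one.mp k), DeMorganAlgebra.neg_bot]
  | inf r s h k =>
    rw [FreeDM.lift_inf, e0, e1] at *
    refine ⟨fun m => ?_, fun m => ?_⟩
    -- In a chain, a meet equal to 0 has a factor equal to 0.
    · rcases min_eq_bot.mp m with m | m
      · rw [h.1 m, bot_inf_eq]
      · rw [k.1 m, inf_bot_eq]
    · rw [h.2 (inf_eq_top_iff.mp m).1, k.2 (inf_eq_top_iff.mp m).2, inf_top_eq]
  | sup r s h k =>
    rw [FreeDM.lift_sup, e0, e1] at *
    refine ⟨fun m => ?_, fun m => ?_⟩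
    · rw [h.1 (sup_eq_bot_iff.mp m).1, k.1 (sup_eq_bot_iff.mp m).2, sup_bot_eq]
    · rcases max_eq_top.mp m with m | m
      · rw [h.2 m, top_sup_eq]
      · rw [k.2 m, sup_top_eq]

/-- The truncated map `t ↦ max 0 (2 t - 1)` on the unit interval. -/
noncomputable def sharpen (t : unitInterval) : unitInterval :=
  Set.projIcc (0 : ℝ) 1 zero_le_one (2 * t - 1)

theorem sharpen_coe (t : unitInterval) : (sharpen t : ℝ) = max 0 (2 * (t : ℝ) - 1) := by
  have h := t.2.2
  rw [sharpen, Set.coe_projIcc, min_eq_right (by linarith)]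

theorem monotone_sharpen : Monotone sharpen := fun s t h =>
  Set.monotone_projIcc _ (by have : (s : ℝ) ≤ t := h; linarith)

theorem continuous_sharpen : Continuous sharpen :=
  continuous_projIcc.comp (by fun_prop)

theorem sharpen_zero : sharpen 0 = 0 := by
  ext; rw [sharpen_coe]; norm_num

theorem sharpen_one : sharpen 1 = 1 := by
  ext; rw [sharpen_coe]; norm_num

theorem sharpen_eq_one {t : unitInterval} : sharpen t = 1 ↔ t = 1 := by
  refine ⟨fun h => ?_, fun h => h ▸ sharpen_one⟩
  have h := congrArg Subtype.val h
  rw [sharpen_coe] at h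
  have ht := t.2.2
  ext
  rcases max_cases (0 : ℝ) (2 * (t : ℝ) - 1) with m | m
  · rw [m.1] at h; norm_num at h
  · rw [m.1] at h
    simp only [Set.Icc.coe_one] at h ⊢
    linarith

/-- One of t and 1 - t is at most 1/2, where `sharpen` vanishes. The identity in place of `sharpen`
would violate this relation, which the face lattice imposes. -/
theorem sharpen_symm_inf_sharpen (t : unitInterval) :
    sharpen (unitInterval.symm t) ⊓ sharpen t = ⊥ := by
  rcases le_total (t : ℝ) (1 / 2) with h | h
  · have : sharpen t = ⊥ := by
      ext; rw [sharpen_coe, max_eq_left (by linarith)]; rfl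
    rw [this, inf_bot_eq]
  · have : sharpen (unitInterval.symm t) = ⊥ := by
      ext; rw [sharpen_coe, unitInterval.coe_symm_eq, max_eq_left (by linarith)]; rfl
    rw [this, bot_inf_eq]

/-- The dilation of the unit interval about its midpoint by the factor `1 / max d (1 / 2)`,
truncated to the unit interval. -/
noncomputable def stretch (d t : unitInterval) : unitInterval :=
  Set.projIcc (0 : ℝ) 1 zero_le_one (1 / 2 + (t - 1 / 2) / max (d : ℝ) (1 / 2))

theorem half_le_max (d : unitInterval) : (1 / 2 : ℝ) ≤ max (d : ℝ) (1 / 2) := le_max_right _ _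

theorem max_half_pos (d : unitInterval) : (0 : ℝ) < max (d : ℝ) (1 / 2) :=
  lt_of_lt_of_le (by norm_num) (half_le_max d)

theorem max_half_le_one (d : unitInterval) : max (d : ℝ) (1 / 2) ≤ 1 :=
  max_le d.2.2 (by norm_num)

theorem monotone_stretch (d : unitInterval) : Monotone (stretch d) := fun s t h =>
  Set.monotone_projIcc _ (by
    have h : (s : ℝ) ≤ t := h
    have := max_half_pos d
    gcongr)

/-- Joint continuity matters because the factor will vary with the point. The bound 1/2 keeps the
denominator away from 0. -/
theorem continuous_stretch : Continuous fun p : unitInterval × unitInterval => stretch p.1 p.2 := by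
  refine continuous_projIcc.comp ?_
  refine continuous_const.add (Continuous.div (by fun_prop) (by fun_prop) fun p => ?_)
  exact (max_half_pos p.1).ne'

theorem stretch_zero (d : unitInterval) : stretch d 0 = 0 := by
  refine Set.projIcc_of_le_left _ ?_
  have h : 1 / 2 ≤ (1 / 2) / max (d : ℝ) (1 / 2) := by
    rw [le_div_iff₀ (max_half_pos d)]
    linarith [max_half_le_one d]
  rw [Set.Icc.coe_zero, zero_sub, neg_div]
  linarith

theorem stretch_one_left (t : unitInterval) : stretch 1 t = t := by
  have h : max ((1 : unitInterval) : ℝ) (1 / 2) = 1 := by norm_num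
  rw [stretch, h, div_one, add_sub_cancel, Set.projIcc_val]

/-- The dilation is centred at the fixed point 1/2 of the reversal, and truncation to [0,1] is
symmetric about that point. -/
theorem stretch_symm (d t : unitInterval) :
    stretch d (unitInterval.symm t) = unitInterval.symm (stretch d t) := by
  ext
  rw [unitInterval.coe_symm_eq, stretch, stretch, Set.coe_projIcc, Set.coe_projIcc,
    unitInterval.coe_symm_eq]
  have h : 1 / 2 + (1 - (t : ℝ) - 1 / 2) / max (d : ℝ) (1 / 2)
      = 1 - (1 / 2 + ((t : ℝ) - 1 / 2) / max (d : ℝ) (1 / 2)) := by ring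
  rw [h]
  generalize 1 / 2 + ((t : ℝ) - 1 / 2) / max (d : ℝ) (1 / 2) = a
  rcases le_total a 0 with h0 | h0
  · rw [min_eq_left (by linarith), min_eq_right (by linarith), max_eq_left h0]; norm_num
  · rcases le_total a 1 with h1 | h1
    · rw [min_eq_right (by linarith), min_eq_right h1, max_eq_right (by linarith),
        max_eq_right h0]
    · rw [min_eq_right (by linarith), min_eq_left h1, max_eq_left (by linarith)]; norm_num

/-- Multiplication by `1 / max d (1 / 2)`, truncated to the unit interval. -/
noncomputable def amplify (d t : unitInterval) : unitInterval :=
  Set.projIcc (0 : ℝ) 1 zero_le_one (t / max (d : ℝ) (1 / 2))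

theorem monotone_amplify (d : unitInterval) : Monotone (amplify d) := fun s t h =>
  Set.monotone_projIcc _ (by
    have h : (s : ℝ) ≤ t := h
    have := max_half_pos d
    gcongr)

theorem amplify_zero (d : unitInterval) : amplify d 0 = 0 :=
  Set.projIcc_of_le_left _ (by simp)

theorem amplify_of_le {d t : unitInterval} (h : max (d : ℝ) (1 / 2) ≤ t) : amplify d t = 1 :=
  Set.projIcc_of_right_le _ (by rwa [le_div_iff₀ (max_half_pos d), one_mul])

/-- The map t ↦ 2t - 1 moves the centre of dilation to 0, so dilation about 1/2 becomes
multiplication by the same factor; the cases check the truncations. -/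
theorem sharpen_stretch (d t : unitInterval) :
    sharpen (stretch d t) = amplify d (sharpen t) := by
  ext
  rw [sharpen_coe, stretch, amplify, Set.coe_projIcc, Set.coe_projIcc, sharpen_coe]
  have hm := max_half_pos d
  generalize max (d : ℝ) (1 / 2) = m at hm
  have e : 1 / 2 + ((t : ℝ) - 1 / 2) / m = (1 + (2 * t - 1) / m) / 2 := by ring
  rw [e]
  rcases le_total (2 * (t : ℝ) - 1) 0 with h | h
  · have h' := div_nonpos_of_nonpos_of_nonneg h hm.le
    rw [max_eq_left h, zero_div, min_eq_right (a := (1 : ℝ)) (b := 0) (by norm_num), max_self,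
      min_eq_right (by linarith), max_eq_left]
    rcases max_cases (0 : ℝ) ((1 + (2 * (t : ℝ) - 1) / m) / 2) with k | k <;> rw [k.1] <;> linarith
  · have h' := div_nonneg h hm.le
    rw [max_eq_right h]
    generalize (2 * (t : ℝ) - 1) / m = a at h'
    rcases le_total a 1 with k | k
    · rw [min_eq_right (by linarith), min_eq_right k, max_eq_right (a := (0 : ℝ)) (b := (1 + a) / 2)
        (by linarith)]
      congr 1
      ring
    · rw [min_eq_left (by linarith), min_eq_left k]; norm_num

/-! ### The degree to which a face formula holds at a point of a topological cube -/

/-- The degree, in the unit interval, to which a face formula holds at a point. -/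
noncomputable def FaceLattice.degree {α : Type u} (x : α → unitInterval) :
    FaceLattice α → unitInterval :=
  FaceLattice.lift (fun k => sharpen (unitInterval.symm (x k))) (fun k => sharpen (x k))
    fun k => sharpen_symm_inf_sharpen (x k)

namespace FaceLattice

variable {α β : Type u}

@[simp] theorem degree_bot (x : α → unitInterval) : degree x ⊥ = 0 := rfl
@[simp] theorem degree_top (x : α → unitInterval) : degree x ⊤ = 1 := rfl
@[simp] theorem degree_eq0 (x : α → unitInterval) (i : α) :
    degree x (eq0 i) = sharpen (unitInterval.symm (x i)) := rfl
@[simp] theorem degree_eq1 (x : α → unitInterval) (i : α) :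
    degree x (eq1 i) = sharpen (x i) := rfl
@[simp] theorem degree_inf (x : α → unitInterval) (r s : FaceLattice α) :
    degree x (r ⊓ s) = degree x r ⊓ degree x s := lift_inf _ _ _ _ _
@[simp] theorem degree_sup (x : α → unitInterval) (r s : FaceLattice α) :
    degree x (r ⊔ s) = degree x r ⊔ degree x s := lift_sup _ _ _ _ _

theorem continuous_degree (φ : FaceLattice α) : Continuous fun x => degree x φ := by
  induction φ using FaceLattice.induction with
  | bot => exact continuous_const
  | top => exact continuous_const
  | eq0 i =>
    exact continuous_sharpen.comp (unitInterval.continuous_symm.comp (continuous_apply i))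
  | eq1 i => exact continuous_sharpen.comp (continuous_apply i)
  | inf r s h k => simpa using h.min k
  | sup r s h k => simpa using h.max k

/-- Being monotone, `sharpen` preserves min and max. The two equations are proved together because
negation exchanges them. -/
theorem degree_isOne_isZero (x : α → unitInterval) (r : FreeDM α) :
    degree x (isOne r) = sharpen (FreeDM.lift x r) ∧
      degree x (isZero r) = sharpen (unitInterval.symm (FreeDM.lift x r)) := by
  induction r using FreeDM.induction with
  | bot =>
    exact ⟨sharpen_zero.symm, (sharpen_one.symm.trans (congrArg _ unitInterval.symm_zero.symm))⟩
  | top =>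
    exact ⟨sharpen_one.symm, (sharpen_zero.symm.trans (congrArg _ unitInterval.symm_one.symm))⟩
  | var i => exact ⟨rfl, rfl⟩
  | neg r h =>
    rw [isOne_neg, isZero_neg, h.1, h.2, FreeDM.lift_neg]
    exact ⟨rfl, congrArg _ (unitInterval.symm_symm _).symm⟩
  | inf r s h k =>
    rw [isOne_inf, isZero_inf, degree_inf, degree_sup, h.1, h.2, k.1, k.2, FreeDM.lift_inf,
      monotone_sharpen.map_inf, ← monotone_sharpen.map_sup]
    exact ⟨rfl, congrArg _ (DeMorganAlgebra.neg_inf _ _).symm⟩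
  | sup r s h k =>
    rw [isOne_sup, isZero_sup, degree_inf, degree_sup, h.1, h.2, k.1, k.2, FreeDM.lift_sup,
      monotone_sharpen.map_sup, ← monotone_sharpen.map_inf]
    exact ⟨rfl, congrArg _ (DeMorganAlgebra.neg_sup _ _).symm⟩

/-- Both sides are lattice homomorphisms in φ that agree on generators. This naturality of the
degree is one half of uniformity. -/
theorem degree_subst (x : β → unitInterval) (f : α → FreeDM β) (φ : FaceLattice α) :
    degree x (subst f φ) = degree (fun i => FreeDM.lift x (f i)) φ := by
  induction φ using FaceLattice.induction with
  | bot => rfl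
  | top => rfl
  | eq0 i => exact (degree_isOne_isZero x (f i)).2
  | eq1 i => exact (degree_isOne_isZero x (f i)).1
  | inf r s h k => simp [h, k]
  | sup r s h k => simp [h, k]

/-- The generators are covered by `sharpen_stretch`; the formula propagates because `amplify d` is
monotone and fixes 0 and 1. It will be used with d the degree of φ at x itself. -/
theorem degree_stretch (d : unitInterval) (x : α → unitInterval) (φ : FaceLattice α) :
    degree (fun k => stretch d (x k)) φ = amplify d (degree x φ) := by
  induction φ using FaceLattice.induction with
  | bot => exact (amplify_zero d).symm
  | top => exact (amplify_of_le (max_half_le_one d)).symm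
  | eq0 i => rw [degree_eq0, degree_eq0, ← stretch_symm, sharpen_stretch]
  | eq1 i => exact sharpen_stretch d _
  | inf r s h k => rw [degree_inf, degree_inf, h, k, (monotone_amplify d).map_inf]
  | sup r s h k => rw [degree_sup, degree_sup, h, k, (monotone_amplify d).map_sup]

end FaceLattice

namespace Cube

theorem degree_restrict {I J : Cube} (φ : I.Face) (f : J ⟶ I) (y : J.Space) :
    FaceLattice.degree y (φ.restrict f) = FaceLattice.degree (realize f y) φ :=
  FaceLattice.degree_subst y (value f) φ

theorem realize_comp_apply {K J I : Cube} (g : K ⟶ J) (f : J ⟶ I) (y : K.Space) :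
    realize (g ≫ f) y = realize f (realize g y) := by
  rw [realize_comp, ContinuousMap.comp_apply]

/-! ### Faces of a cube -/

/-- The cube on the names left free by a partial assignment of end points. -/
def freeCube {K : Cube} (σ : K.Names → Option Bool) : Cube :=
  ⟨(Finset.univ.filter fun k => σ k = none).map (Function.Embedding.subtype _)⟩

theorem mem_freeCube {K : Cube} {σ : K.Names → Option Bool} {k : K.Names} (h : σ k = none) :
    k.1 ∈ (freeCube σ).names := by
  simp [freeCube, h]

theorem exists_of_mem_freeCube {K : Cube} {σ : K.Names → Option Bool} {k : ℕ}
    (h : k ∈ (freeCube σ).names) : ∃ h : k ∈ K.names, σ ⟨k, h⟩ = none := by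
  simpa [freeCube] using h

/-- A name left free by a partial assignment, seen as a name of the ambient cube. -/
def freeName {K : Cube} (σ : K.Names → Option Bool) (k : (freeCube σ).Names) : K.Names :=
  ⟨k.1, (exists_of_mem_freeCube k.2).1⟩

theorem apply_freeName {K : Cube} (σ : K.Names → Option Bool) (k : (freeCube σ).Names) :
    σ (freeName σ k) = none := (exists_of_mem_freeCube k.2).2

/-- The end point of a de Morgan algebra named by a truth value. -/
def endpoint {α : Type u} [DeMorganAlgebra α] (b : Bool) : α := if b then ⊤ else ⊥

/-- The inclusion of the face of a cube on which a partial assignment of end points holds. -/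
def faceHom {K : Cube} (σ : K.Names → Option Bool) : freeCube σ ⟶ K :=
  homOf fun k =>
    if h : σ k = none then FreeDM.var ⟨k.1, mem_freeCube h⟩ else endpoint ((σ k).getD false)

theorem value_faceHom_none {K : Cube} {σ : K.Names → Option Bool} {k : K.Names}
    (h : σ k = none) : value (faceHom σ) k = FreeDM.var ⟨k.1, mem_freeCube h⟩ := by
  rw [faceHom, value_homOf, dif_pos h]

theorem value_faceHom_some {K : Cube} {σ : K.Names → Option Bool} {k : K.Names} {b : Bool}
    (h : σ k = some b) : value (faceHom σ) k = endpoint b := by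
  rw [faceHom, value_homOf, dif_neg (by simp [h]), h]
  rfl

/-- The projection of a cube to the coordinates left free by a partial assignment. -/
def freeProj {K : Cube} (σ : K.Names → Option Bool) (z : K.Space) : (freeCube σ).Space :=
  fun k => z (freeName σ k)

theorem continuous_freeProj {K : Cube} (σ : K.Names → Option Bool) : Continuous (freeProj σ) :=
  continuous_pi fun k => continuous_apply (freeName σ k)

/-- The closed face of the topological cube on which a partial assignment holds. -/
def closedFace {K : Cube} (σ : K.Names → Option Bool) : Set K.Space :=
  {z | ∀ k b, σ k = some b → z k = endpoint b}

theorem isClosed_closedFace {K : Cube} (σ : K.Names → Option Bool) : IsClosed (closedFace σ) := by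
  simp only [closedFace, Set.ofPred_forall]
  exact isClosed_iInter fun k => isClosed_iInter fun b => isClosed_iInter fun _ =>
    isClosed_eq (continuous_apply k) continuous_const

theorem lift_endpoint {α : Type u} {D : Type v} [DeMorganAlgebra D] (e : α → D) (b : Bool) :
    FreeDM.lift e (endpoint b) = endpoint b := by
  cases b <;> rfl

theorem realize_faceHom_freeProj {K : Cube} {σ : K.Names → Option Bool} {z : K.Space}
    (hz : z ∈ closedFace σ) : realize (faceHom σ) (freeProj σ z) = z := by
  funext k
  change FreeDM.lift _ (value (faceHom σ) k) = z k
  rcases h : σ k with _ | b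
  · rw [value_faceHom_none h]; rfl
  · rw [value_faceHom_some h, lift_endpoint, hz k b h]

/-- The partial assignment recording the coordinates of a point that are end points. -/
noncomputable def pattern {K : Cube} (z : K.Space) : K.Names → Option Bool := fun k =>
  open scoped Classical in if z k = 0 then some false else if z k = 1 then some true else none

theorem pattern_cases {K : Cube} (z : K.Space) (k : K.Names) :
    (z k = 0 ∧ pattern z k = some false) ∨ (z k = 1 ∧ pattern z k = some true) ∨
      (z k ≠ 0 ∧ z k ≠ 1 ∧ pattern z k = none) := by
  by_cases h0 : z k = 0
  · exact .inl ⟨h0, if_pos h0⟩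
  · by_cases h1 : z k = 1
    · exact .inr (.inl ⟨h1, by rw [pattern, if_neg h0, if_pos h1]⟩)
    · exact .inr (.inr ⟨h0, h1, by rw [pattern, if_neg h0, if_neg h1]⟩)

theorem mem_closedFace_pattern {K : Cube} (z : K.Space) : z ∈ closedFace (pattern z) := by
  intro k b h
  rcases pattern_cases z k with ⟨h0, e⟩ | ⟨h0, e⟩ | ⟨-, -, e⟩ <;> rw [e] at h <;> cases h <;>
    exact h0

theorem freeProj_pattern_interior {K : Cube} (z : K.Space) (k : (freeCube (pattern z)).Names) :
    freeProj (pattern z) z k ≠ 0 ∧ freeProj (pattern z) z k ≠ 1 := by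
  have h := apply_freeName (pattern z) k
  rcases pattern_cases z (freeName (pattern z) k) with ⟨-, e⟩ | ⟨-, e⟩ | ⟨h0, h1, -⟩
  · rw [e] at h; cases h
  · rw [e] at h; cases h
  · exact ⟨h0, h1⟩

/-- A generator of degree 1 forces an end-point coordinate, which the pattern records, and in a
chain a join of degree 1 has a joinand of degree 1. A numerical condition at one point thus becomes
an identity in the face lattice of the smallest face containing that point. -/
theorem restrict_faceHom_pattern {K : Cube} {ψ : K.Face} {z : K.Space}
    (h : FaceLattice.degree z ψ = 1) : ψ.restrict (faceHom (pattern z)) = ⊤ := by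
  unfold Face.restrict
  induction ψ using FaceLattice.induction with
  | bot => exact absurd h zero_ne_one
  | top => rfl
  | eq0 i =>
    have h0 : z i = 0 := unitInterval.symm_eq_one.mp (sharpen_eq_one.mp h)
    rcases pattern_cases z i with ⟨-, e⟩ | ⟨h1, -⟩ | ⟨h1, -, -⟩
    · rw [FaceLattice.subst_eq0, value_faceHom_some e]; rfl
    · exact absurd (h0.symm.trans h1) zero_ne_one
    · exact absurd h0 h1
  | eq1 i =>
    have h0 : z i = 1 := sharpen_eq_one.mp h
    rcases pattern_cases z i with ⟨h1, -⟩ | ⟨-, e⟩ | ⟨-, h1, -⟩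
    · exact absurd (h1.symm.trans h0) zero_ne_one
    · rw [FaceLattice.subst_eq1, value_faceHom_some e]; rfl
    · exact absurd h0 h1
  | inf r s hr hs =>
    rw [FaceLattice.degree_inf] at h
    have h := inf_eq_top_iff.mp h
    rw [FaceLattice.subst_inf, hr h.1, hs h.2, inf_top_eq]
  | sup r s hr hs =>
    rw [FaceLattice.degree_sup] at h
    rcases max_eq_top.mp h with h | h
    · rw [FaceLattice.subst_sup, hr h, top_sup_eq]
    · rw [FaceLattice.subst_sup, hs h, sup_top_eq]

theorem degree_eq_one_of_restrict_eq_top {J K : Cube} {ψ : K.Face} {f : J ⟶ K}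
    (h : ψ.restrict f = ⊤) (y : J.Space) : FaceLattice.degree (realize f y) ψ = 1 := by
  rw [← degree_restrict, h, FaceLattice.degree_top]

/-- A morphism that sends a point of the open cube into a closed face factors through that
face. -/
theorem exists_factor_faceHom {J K : Cube} (f : J ⟶ K) {y : J.Space}
    (hy : ∀ k, y k ≠ 0 ∧ y k ≠ 1) {σ : K.Names → Option Bool}
    (hσ : realize f y ∈ closedFace σ) :
    ∃ h : J ⟶ freeCube σ, f = h ≫ faceHom σ ∧ realize h y = freeProj σ (realize f y) := by
  -- The factor forgets the coordinates fixed by σ. On those, f must be shown to be constant.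
  refine ⟨homOf fun k => value f (freeName σ k), ?_, rfl⟩
  ext k
  rw [value_comp]
  rcases h : σ k with _ | b
  · rw [value_faceHom_none h]; rfl
  · rw [value_faceHom_some h, lift_endpoint]
    have e : FreeDM.lift y (value f k) = endpoint b := hσ k b h
    cases b
    · exact (FreeDM.eq_bot_or_top_of_interior hy _).1 e
    · exact (FreeDM.eq_bot_or_top_of_interior hy _).2 e

end Cube

/-! ### Gluing partial elements of singular cubical sets -/

section Glue

variable {X : Type u} [TopologicalSpace X]

/-- An element of a fibre of a singular cubical set, as a continuous map. -/
def toMap {I : Cube} {ρ : terminalCubicalSet.obj (op I)} (a : (Sing X).asTy.fib ρ) :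
    C(I.Space, X) := a

theorem toMap_res {I J : Cube} {ρ : terminalCubicalSet.obj (op I)} (a : (Sing X).asTy.fib ρ)
    (f : J ⟶ I) {σ : terminalCubicalSet.obj (op J)} (h : CubicalSet.res ρ f = σ) (y : J.Space) :
    toMap (Ty.res a f h) y = toMap a (Cube.realize f y) := rfl

variable {K : Cube} {ρ : terminalCubicalSet.obj (op K)} {ψ : K.Face}

theorem toMap_val_comp (w : PartialElement (Sing X).asTy ρ ψ) {J L : Cube} (f : J ⟶ K)
    (h : ψ.restrict f = ⊤) (g : L ⟶ J) (h' : ψ.restrict (g ≫ f) = ⊤) (y : L.Space) :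
    toMap (w.val (g ≫ f) h') y = toMap (w.val f h) (Cube.realize g y) := by
  rw [← w.res_val f h g, toMap_res]

theorem toMap_val_congr (w : PartialElement (Sing X).asTy ρ ψ) {J : Cube} {f g : J ⟶ K}
    (e : f = g) (h : ψ.restrict f = ⊤) (k : ψ.restrict g = ⊤) (y : J.Space) :
    toMap (w.val f h) y = toMap (w.val g k) y := by
  subst e
  rfl

/-- The right side involves f and y only through the image point, so the values of a partial element
define a function on points. Since y may lie on the boundary, f is first restricted to the smallest
face containing y. There y is interior, so the restricted morphism factors through the face σ, and
compatibility of w finishes. -/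
theorem toMap_val_eq_faceHom (w : PartialElement (Sing X).asTy ρ ψ) {J : Cube} (f : J ⟶ K)
    (h : ψ.restrict f = ⊤) (y : J.Space) {σ : K.Names → Option Bool}
    (hσ : ψ.restrict (Cube.faceHom σ) = ⊤) (hz : Cube.realize f y ∈ Cube.closedFace σ) :
    toMap (w.val f h) y
      = toMap (w.val (Cube.faceHom σ) hσ) (Cube.freeProj σ (Cube.realize f y)) := by
  have hy := Cube.realize_faceHom_freeProj (Cube.mem_closedFace_pattern y)
  have e : Cube.realize (Cube.faceHom (Cube.pattern y) ≫ f) (Cube.freeProj (Cube.pattern y) y)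
      = Cube.realize f y := by rw [Cube.realize_comp_apply, hy]
  obtain ⟨g, hg, hgy⟩ := Cube.exists_factor_faceHom (Cube.faceHom (Cube.pattern y) ≫ f)
    (Cube.freeProj_pattern_interior y) (σ := σ) (by rwa [e])
  have h' := Cube.Face.restrict_comp_eq_top h (Cube.faceHom (Cube.pattern y))
  have h1 := toMap_val_comp w f h _ h' (Cube.freeProj (Cube.pattern y) y)
  rw [hy] at h1
  rw [← h1, ← e, ← hgy, ← toMap_val_comp w _ hσ g (Cube.Face.restrict_comp_eq_top hσ g)]
  exact toMap_val_congr w hg _ _ _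

open scoped Classical in
/-- The function on the topological cube that glues the values of a partial element on its
extent, and is given by `c` elsewhere. -/
noncomputable def glue (w : PartialElement (Sing X).asTy ρ ψ) (c : K.Space → X) (z : K.Space) :
    X :=
  if h : ψ.restrict (Cube.faceHom (Cube.pattern z)) = ⊤ then
    toMap (w.val (Cube.faceHom (Cube.pattern z)) h) (Cube.freeProj (Cube.pattern z) z)
  else c z

theorem glue_realize (w : PartialElement (Sing X).asTy ρ ψ) (c : K.Space → X) {J : Cube}
    (f : J ⟶ K) (h : ψ.restrict f = ⊤) (y : J.Space) :
    glue w c (Cube.realize f y) = toMap (w.val f h) y := by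
  have hz := Cube.restrict_faceHom_pattern (Cube.degree_eq_one_of_restrict_eq_top h y)
  rw [glue, dif_pos hz]
  exact (toMap_val_eq_faceHom w f h y hz (Cube.mem_closedFace_pattern _)).symm

theorem glue_of_degree_ne_one (w : PartialElement (Sing X).asTy ρ ψ) (c : K.Space → X)
    {z : K.Space} (h : FaceLattice.degree z ψ ≠ 1) : glue w c z = c z := by
  refine dif_neg fun k => h ?_
  have e := Cube.degree_eq_one_of_restrict_eq_top k (Cube.freeProj (Cube.pattern z) z)
  rwa [Cube.realize_faceHom_freeProj (Cube.mem_closedFace_pattern z)] at e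

/-- The pattern of z jumps within a closed face, but the glued value is given there by a single
continuous formula. -/
theorem glue_of_mem_closedFace (w : PartialElement (Sing X).asTy ρ ψ) (c : K.Space → X)
    {σ : K.Names → Option Bool} (hσ : ψ.restrict (Cube.faceHom σ) = ⊤) {z : K.Space}
    (hz : z ∈ Cube.closedFace σ) :
    glue w c z = toMap (w.val (Cube.faceHom σ) hσ) (Cube.freeProj σ z) := by
  conv_lhs => rw [← Cube.realize_faceHom_freeProj hz]
  exact glue_realize w c _ hσ _

theorem continuousOn_glue (w : PartialElement (Sing X).asTy ρ ψ) (c : K.Space → X) :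
    ContinuousOn (glue w c) {z | FaceLattice.degree z ψ = 1} := by
  let ι := {σ : K.Names → Option Bool // ψ.restrict (Cube.faceHom σ) = ⊤}
  have hc : ContinuousOn (glue w c) (⋃ σ : ι, Cube.closedFace σ.1) :=
    -- A finite set of names has only finitely many partial assignments, so pasting along closed
    -- sets applies.
    (locallyFinite_of_finite _).continuousOn_iUnion
      (fun σ => Cube.isClosed_closedFace σ.1) fun σ =>
        ((toMap (w.val (Cube.faceHom σ.1) σ.2)).continuous.comp
          (Cube.continuous_freeProj σ.1)).continuousOn.congr fun z hz =>
            glue_of_mem_closedFace w c σ.2 hz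
  exact hc.mono fun z hz => Set.mem_iUnion.mpr
    ⟨⟨Cube.pattern z, Cube.restrict_faceHom_pattern hz⟩, Cube.mem_closedFace_pattern z⟩

end Glue

/-! ### The composition operation -/

namespace Cube

/-- The point of the topological cube `[0,1]^(I, i)` with coordinates `x` on `I` and `t` at
`i`. -/
def snoc {I : Cube} (i : ℕ) (x : I.Space) (t : unitInterval) : (I.extend i).Space :=
  fun k => if h : k.1 ∈ I.names then x ⟨k.1, h⟩ else t

theorem continuous_snoc {I : Cube} (i : ℕ) :
    Continuous fun p : I.Space × unitInterval => snoc i p.1 p.2 := by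
  refine continuous_pi fun k => ?_
  by_cases h : k.1 ∈ I.names
  · simp only [snoc, h, dite_true]; fun_prop
  · simp only [snoc, h, dite_false]; fun_prop

theorem realize_degen_snoc {I : Cube} (i : ℕ) (x : I.Space) (t : unitInterval) :
    realize (degen I i) (snoc i x t) = x :=
  funext fun k => dif_pos k.2

theorem snoc_new {I : Cube} {i : ℕ} (hi : i ∉ I.names) (x : I.Space) (t : unitInterval) :
    snoc i x t (new I i) = t := dif_neg hi

theorem realize_face {I : Cube} (i : ℕ) (r : FreeDM I.Names) (x : I.Space) :
    realize (face I i r) x = snoc i x (FreeDM.lift x r) := by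
  funext k
  change FreeDM.lift x (value (face I i r) k) = _
  by_cases h : k.1 ∈ I.names <;> simp [face, snoc, h]

theorem snoc_realize_degen {I : Cube} {i : ℕ} (z : (I.extend i).Space) :
    snoc i (realize (degen I i) z) (z (new I i)) = z := by
  funext k
  by_cases h : k.1 ∈ I.names
  · exact dif_pos h
  · refine (dif_neg h).trans (congrArg z (Subtype.ext ?_))
    exact ((Finset.mem_insert.mp k.2).resolve_right h).symm

theorem realize_extendHom_snoc {I J : Cube} (f : J ⟶ I) (i : ℕ) {j : ℕ} (hj : j ∉ J.names)
    (y : J.Space) (t : unitInterval) :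
    realize (extendHom f i j) (snoc j y t) = snoc i (realize f y) t := by
  funext k
  change FreeDM.lift _ (value (extendHom f i j) k) = _
  by_cases h : k.1 ∈ I.names
  · simp only [extendHom, value_homOf, snoc, h, dite_true]
    change realize (degen J j ≫ f) (snoc j y t) ⟨k.1, h⟩ = _
    rw [realize_comp_apply, realize_degen_snoc]
  · simp only [extendHom, value_homOf, h, dite_false, FreeDM.lift_var, snoc_new hj]
    rw [snoc, dif_neg h]

/-- The end point of the retraction of `[0,1]^(I, i)` to the open box of extent `φ`, restricted
to the lid `i = 1`. -/
noncomputable def boxPoint {I : Cube} (i : ℕ) (φ : I.Face) (x : I.Space) : (I.extend i).Space :=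
  snoc i (fun k => stretch (FaceLattice.degree x φ) (x k)) (sharpen (FaceLattice.degree x φ))

theorem continuous_boxPoint {I : Cube} (i : ℕ) (φ : I.Face) : Continuous (boxPoint i φ) := by
  have hd := FaceLattice.continuous_degree φ
  refine (continuous_snoc i).comp (Continuous.prodMk (continuous_pi fun k => ?_)
    (continuous_sharpen.comp hd))
  exact continuous_stretch.comp (hd.prodMk (continuous_apply k))

theorem boxPoint_mem {I : Cube} {i : ℕ} (hi : i ∉ I.names) (φ : I.Face) (x : I.Space) :
    FaceLattice.degree (boxPoint i φ x) (φ.restrict (degen I i)) = 1 ∨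
      boxPoint i φ x (new I i) = 0 := by
  rcases le_total (FaceLattice.degree x φ : ℝ) (1 / 2) with h | h
  · right
    rw [boxPoint, snoc_new hi]
    ext
    rw [sharpen_coe, max_eq_left (by linarith)]
    rfl
  · left
    rw [degree_restrict, boxPoint, realize_degen_snoc, FaceLattice.degree_stretch]
    -- Here max(d, 1/2) = d, so the dilation scales the degree d to 1.
    exact amplify_of_le (max_le le_rfl h)

/-- By naturality of the degree, the dilation factor and the height agree on both sides; the
dilation itself commutes with f as a de Morgan endomorphism. -/
theorem boxPoint_restrict {I J : Cube} (φ : I.Face) (f : J ⟶ I) (i : ℕ) {j : ℕ}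
    (hj : j ∉ J.names) (y : J.Space) :
    realize (extendHom f i j) (boxPoint j (φ.restrict f) y) = boxPoint i φ (realize f y) := by
  rw [boxPoint, boxPoint, realize_extendHom_snoc f i hj, degree_restrict]
  congr 1
  funext k
  exact FreeDM.map_lift_unitInterval _ (monotone_stretch _) (stretch_zero _) (stretch_symm _) y _

theorem boxPoint_top {I : Cube} (i : ℕ) (x : I.Space) :
    boxPoint i ⊤ x = realize (face1 I i) x := by
  rw [boxPoint, FaceLattice.degree_top, sharpen_one, face1, realize_face]
  simp only [stretch_one_left]
  rfl

end Cube

/-! ### The map on the open box and the resulting composition -/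

section Composition

variable {X : Type u} [TopologicalSpace X]

/-- The function on the topological cube determined by the data of a composition problem: the
sides on their extent, the cap elsewhere. -/
noncomputable def boxMap {I : Cube} {i : ℕ} (x : CompInput (Sing X).asTy I i) :
    (I.extend i).Space → X :=
  glue x.side fun z => toMap x.cap (Cube.realize (Cube.degen I i) z)

/-- The sides take precedence in the definition, so the content is their agreement with the cap on
the overlap, that is, the compatibility condition of the input. -/
theorem boxMap_cap {I : Cube} {i : ℕ} (x : CompInput (Sing X).asTy I i) {z : (I.extend i).Space}
    (hz : z (Cube.new I i) = 0) :
    boxMap x z = toMap x.cap (Cube.realize (Cube.degen I i) z) := by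
  by_cases h : FaceLattice.degree z (x.extent.restrict (Cube.degen I i)) = 1
  · rw [Cube.degree_restrict] at h
    set p := Cube.realize (Cube.degen I i) z with hp
    have ht := Cube.restrict_faceHom_pattern h
    have ep := Cube.realize_faceHom_freeProj (Cube.mem_closedFace_pattern p)
    -- A point with i-th coordinate 0 is reached through (i0) from the smallest face containing its
    -- projection p, where the compatibility condition applies.
    have ez : Cube.realize (Cube.faceHom (Cube.pattern p) ≫ Cube.face0 I i)
        (Cube.freeProj (Cube.pattern p) p) = z := by
      rw [Cube.realize_comp_apply, ep, Cube.face0, Cube.realize_face, FreeDM.lift_bot]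
      conv_rhs => rw [← Cube.snoc_realize_degen z, hz]
      rfl
    conv_lhs => rw [← ez]
    rw [boxMap, glue_realize _ _ _ (Cube.Face.restrict_degen_face0 ht), ← x.cap_res _ ht,
      toMap_res, ep]
  · exact glue_of_degree_ne_one _ _ h

theorem continuousOn_boxMap {I : Cube} {i : ℕ} (x : CompInput (Sing X).asTy I i) :
    ContinuousOn (boxMap x)
      ({z | FaceLattice.degree z (x.extent.restrict (Cube.degen I i)) = 1} ∪
        {z | z (Cube.new I i) = 0}) := by
  refine (continuousOn_glue _ _).union_of_isClosed ?_
    (isClosed_eq (FaceLattice.continuous_degree _) continuous_const)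
    (isClosed_eq (continuous_apply _) continuous_const)
  exact ((toMap x.cap).continuous.comp (Cube.realize (Cube.degen I i)).continuous).continuousOn.congr
    fun z hz => boxMap_cap x hz

/-- This holds at every point, not only on the box: the test for degree 1 is natural, so both sides
use the side values or both use the cap. -/
theorem boxMap_pullback {I J : Cube} {i : ℕ} (x : CompInput (Sing X).asTy I i) (f : J ⟶ I) (j : ℕ)
    (hj : j ∉ J.names) (z : (J.extend j).Space) :
    boxMap (x.pullback f j hj) z = boxMap x (Cube.realize (Cube.extendHom f i j) z) := by
  by_cases h : FaceLattice.degree z ((x.extent.restrict f).restrict (Cube.degen J j)) = 1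
  · have ht := Cube.restrict_faceHom_pattern h
    have ez := Cube.realize_faceHom_freeProj (Cube.mem_closedFace_pattern z)
    rw [← ez, ← Cube.realize_comp_apply, boxMap, boxMap,
      glue_realize _ _ _ (Cube.Face.restrict_degen_extendHom ht)]
    exact glue_realize (x.pullback f j hj).side _ _ ht _
  · have e : FaceLattice.degree (Cube.realize (Cube.extendHom f i j) z)
        (x.extent.restrict (Cube.degen I i)) ≠ 1 := by
      rwa [← Cube.degree_restrict, ← Cube.Face.restrict_comp, Cube.extendHom_degen,
        Cube.Face.restrict_comp]
    rw [boxMap, boxMap, glue_of_degree_ne_one _ _ e]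
    refine (glue_of_degree_ne_one _ _ h).trans ?_
    rw [← Cube.realize_comp_apply, Cube.extendHom_degen, Cube.realize_comp_apply]
    rfl

/-- Composition in a singular cubical set. -/
noncomputable def singComp {I : Cube} {i : ℕ} (x : CompInput (Sing X).asTy I i) : C(I.Space, X) where
  toFun y := boxMap x (Cube.boxPoint i x.extent y)
  continuous_toFun := (continuousOn_boxMap x).comp_continuous (Cube.continuous_boxPoint i x.extent)
    fun y => Cube.boxPoint_mem x.fresh x.extent y

/-- The composition structure of a singular cubical set. -/
noncomputable def singCompStructure (X : Type u) [TopologicalSpace X] : (Sing X).CompStructure where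
  comp x := singComp x
  uniform x f j hj := ContinuousMap.ext fun y =>
    (congrArg (boxMap x) (Cube.boxPoint_restrict x.extent f _ hj y).symm).trans
      (boxMap_pullback x f j hj _).symm
  -- For full extent the box point is (y, 1), where the glued map is the side at (i1).
  comp_top {_ i} x h := ContinuousMap.ext fun y =>
    (congrArg (boxMap x) ((congrArg (fun φ => Cube.boxPoint i φ y) h).trans
      (Cube.boxPoint_top i y))).trans (glue_realize x.side _ _ _ y)

end Composition

end Cubical

/-- The singular cubical set of a topological space has a composition structure. -/
theorem mainTheorem10 (X : Type u) [TopologicalSpace X] :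
    Nonempty (Cubical.CubicalSet.CompStructure (Cubical.Sing X)) :=
  ⟨Cubical.singCompStructure X⟩
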